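/- Let $X$ be a proper CAT(0) space without Euclidean factor, i.e. $X$ is not isometric to an $\ell^2$-product $Y\times\mathbf{R}^n$ with $Y$ a metric space and $n\ge 1$. Let $G$ be a locally compact (Hausdorff) group acting continuously by isometries on $X$. Suppose that the action is minimal, meaning that $X$ has no non-empty closed convex $G$-invariant subset other than $X$ itself, and that $G$ has no global fixed point in the boundary at infinity $\partial X$ (the set of asymptoty classes of geodesic rays). Then every closed subgroup $\Gamma\le G$ of finite invariant covolume (i.e. such that $G/\Gamma$ carries a non-zero finite $G$-invariant regular Borel measure) also acts minimally on $X$ and without global fixed point in $\partial X$. In particular, this holds for every lattice $\Gamma$ in $G$, i.e. every discrete subgroup of finite invariant covolume. -/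

import Mathlib

open scoped NNReal

namespace GeometricDensity

universe u v

section Metric

variable (X : Type u) [MetricSpace X]

/-- A CAT(0) space: a geodesic metric space all of whose geodesic triangles are at least as thin
as their comparison triangles in the Euclidean plane. In a geodesic space the points `p` with
`dist x p + dist p y = dist x y` are exactly those lying on some geodesic segment from `x` to `y`;
`x' y' z'` is a comparison triangle for the vertices `x y z`, and `p'`, `q'` are the comparison
points of the points `p`, `q` lying on two sides issuing from the (arbitrary) vertex `x`. -/
structure IsCAT0 : Prop where
  geodesic : ∀ x y : X, ∃ γ : ℝ → X, γ 0 = x ∧ γ (dist x y) = y ∧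
    ∀ s ∈ Set.Icc 0 (dist x y), ∀ t ∈ Set.Icc 0 (dist x y), dist (γ s) (γ t) = |s - t|
  comparison : ∀ (x y z p q : X) (x' y' z' p' q' : EuclideanSpace ℝ (Fin 2)),
    dist x' y' = dist x y → dist y' z' = dist y z → dist x' z' = dist x z →
    dist x p + dist p y = dist x y → dist x' p' = dist x p → dist p' y' = dist p y →
    dist x q + dist q z = dist x z → dist x' q' = dist x q → dist q' z' = dist q z →
    dist p q ≤ dist p' q'

/-- `X` has a Euclidean factor: it is isometric to an `ℓ²`-product `Y × ℝⁿ` with `n ≥ 1`. -/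
def HasEuclideanFactor : Prop :=
  ∃ (n : ℕ) (_ : 1 ≤ n) (Y : Type u) (_ : MetricSpace Y),
    Nonempty (X ≃ᵢ WithLp 2 (Y × EuclideanSpace ℝ (Fin n)))

variable {X} in
/-- Convexity: a set containing every point of every geodesic segment between two of its points. -/
def IsGeodesicallyConvex (C : Set X) : Prop :=
  ∀ x ∈ C, ∀ y ∈ C, ∀ z : X, dist x z + dist z y = dist x y → z ∈ C

/-- Geodesic rays: isometric embeddings of `[0, ∞)`. -/
def GeodesicRay : Type u := {c : ℝ≥0 → X // Isometry c}

/-- Two geodesic rays are asymptotic if they stay at bounded distance from each other. -/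
instance asymptoticSetoid : Setoid (GeodesicRay X) where
  r c c' := ∃ K : ℝ, ∀ t : ℝ≥0, dist (c.1 t) (c'.1 t) ≤ K
  iseqv :=
    { refl := fun c => ⟨0, fun t => (dist_self (c.1 t)).le⟩
      symm := fun ⟨K, hK⟩ => ⟨K, fun t => by rw [dist_comm]; exact hK t⟩
      trans := fun ⟨K, hK⟩ ⟨L, hL⟩ =>
        ⟨K + L, fun t => (dist_triangle _ _ _).trans (add_le_add (hK t) (hL t))⟩ }

/-- The boundary at infinity `∂X`: asymptoty classes of geodesic rays. -/
def Boundary : Type u := Quotient (asymptoticSetoid X)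

end Metric

section Action

variable (G : Type v) [Group G] (X : Type u) [MetricSpace X] [MulAction G X] [IsIsometricSMul G X]

/-- The action of a group of isometries on `∂X`, induced by `(g • c) t = g • c t` on rays. -/
instance boundaryAction : MulAction G (Boundary X) where
  smul g := Quotient.map (fun c : GeodesicRay X => ⟨fun t => g • c.1 t, (isometry_smul X g).comp c.2⟩)
    (fun _ _ ⟨K, hK⟩ => ⟨K, fun t => by simpa only [dist_smul] using hK t⟩)
  one_smul ξ := by
    induction ξ using Quotient.inductionOn with
    | h c => exact congrArg (Quotient.mk _) (Subtype.ext (funext fun t => one_smul G (c.1 t)))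
  mul_smul g h ξ := by
    induction ξ using Quotient.inductionOn with
    | h c => exact congrArg (Quotient.mk _) (Subtype.ext (funext fun t => mul_smul g h (c.1 t)))

/-- A subgroup of a group acting by isometries acts by isometries. -/
instance subgroupIsIsometricSMul (Γ : Subgroup G) : IsIsometricSMul Γ X :=
  ⟨fun g => isometry_smul X (g : G)⟩

/-- The action of `G` on `X` has a global fixed point in `∂X`. -/
def HasFixedPointAtInfinity : Prop :=
  ∃ ξ : Boundary X, ∀ g : G, g • ξ = ξ

/-- The action of `G` on `X` is minimal in the CAT(0) sense: there is no non-empty closed convex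
`G`-invariant subset other than `X` itself. -/
def ActsMinimally : Prop :=
  ∀ C : Set X, C.Nonempty → IsClosed C → IsGeodesicallyConvex C →
    (∀ g : G, ∀ x ∈ C, g • x ∈ C) → C = Set.univ

end Action

section Covolume

variable {G : Type v} [Group G] [TopologicalSpace G]

/-- `Γ` has finite invariant covolume in `G`: the space `G ⧸ Γ` carries a non-zero finite
`G`-invariant regular Borel measure. -/
def HasFiniteInvariantCovolume (Γ : Subgroup G) : Prop :=
  letI : MeasurableSpace (G ⧸ Γ) := borel (G ⧸ Γ)
  ∃ μ : MeasureTheory.Measure (G ⧸ Γ), μ ≠ 0 ∧ MeasureTheory.IsFiniteMeasure μ ∧ μ.Regular ∧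
    MeasureTheory.SMulInvariantMeasure G (G ⧸ Γ) μ

/-- A lattice: a discrete subgroup of finite invariant covolume. -/
def IsLattice (Γ : Subgroup G) : Prop :=
  DiscreteTopology Γ ∧ HasFiniteInvariantCovolume Γ

end Covolume

end GeometricDensity

/-! Everything rests on averaging a convex Lipschitz function `f` that each element of `Γ` changes
by an additive constant. The differences `f (g⁻¹ • w) - f (g⁻¹ • x)` depend only on the coset of
`g`, so they can be integrated over `G ⧸ Γ`. The resulting function `F` of `w` is convex and
Lipschitz, and invariance of the measure makes it quasi-invariant under all of `G`.

Such an `F` is constant (`quasiInvariant_const`). If some element changed `F` by a nonzero constant,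
`F` would decrease linearly along an orbit; the direction of steepest descent is then a unique
boundary point, which `G` would have to fix. So `F` is invariant, and by minimality its sublevel
sets are all of `X`. The integrated convexity defect of `f` therefore vanishes, and `f` is affine
(`affineFn_of_quasiInvariant`). If `f` is invariant, truncating it from below shows that it is even
constant (`const_of_invariant`).

Minimality of `Γ` follows by taking `f` to be the distance to an invariant closed convex set. If `Γ`
fixed a boundary point, its Busemann function would be affine. The largest drop of that function
over a ball of fixed radius is `Γ`-invariant, hence constant (`exists_unit_descent`), so gradient
lines run through every point in both directions. They form an isometric flow satisfying Pythagoras'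
theorem, and `X` splits off a line, contrary to hypothesis. -/

open Filter Topology MeasureTheory

namespace GeometricDensity

universe u v

/-! ### Convexity of CAT(0) distances -/

section Geometry

variable {X : Type u} [MetricSpace X]

/-- The point `z` divides a geodesic segment from `x` to `y` in the ratio `t : 1 - t`. -/
structure IsAt (x y : X) (t : ℝ) (z : X) : Prop where
  left : dist x z = t * dist x y
  right : dist z y = (1 - t) * dist x y

theorem IsAt.symm {x y z : X} {t : ℝ} (h : IsAt x y t z) : IsAt y x (1 - t) z :=
  ⟨by rw [dist_comm, h.right, dist_comm x y], by rw [dist_comm, h.left, dist_comm x y]; ring⟩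

theorem IsAt.add {x y z : X} {t : ℝ} (h : IsAt x y t z) : dist x z + dist z y = dist x y := by
  rw [h.left, h.right]; ring

theorem IsAt.smul {G : Type v} [Group G] [MulAction G X] [IsIsometricSMul G X]
    {x y z : X} {t : ℝ} (h : IsAt x y t z) (g : G) : IsAt (g • x) (g • y) t (g • z) :=
  ⟨by simpa only [dist_smul] using h.left, by simpa only [dist_smul] using h.right⟩

theorem exists_isAt_of_add {x y z : X} (h : dist x z + dist z y = dist x y) :
    ∃ t : ℝ, 0 ≤ t ∧ t ≤ 1 ∧ IsAt x y t z := by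
  have h1 := dist_nonneg (x := x) (y := z)
  have h2 := dist_nonneg (x := z) (y := y)
  rcases eq_or_lt_of_le (dist_nonneg (x := x) (y := y)) with h0 | h0
  · exact ⟨0, le_rfl, zero_le_one, by linarith, by linarith⟩
  · refine ⟨dist x z / dist x y, by positivity, ?_, ?_, ?_⟩
    · rw [div_le_one h0]; linarith
    · field_simp
    · field_simp; linarith

theorem IsCAT0.exists_isAt (hX : IsCAT0 X) (x y : X) {t : ℝ} (h0 : 0 ≤ t) (h1 : t ≤ 1) :
    ∃ z, IsAt x y t z := by
  obtain ⟨γ, e0, e1, hγ⟩ := hX.geodesic x y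
  have hd := dist_nonneg (x := x) (y := y)
  have m0 : (0 : ℝ) ∈ Set.Icc 0 (dist x y) := ⟨le_rfl, hd⟩
  have m1 : dist x y ∈ Set.Icc 0 (dist x y) := ⟨hd, le_rfl⟩
  have mt : t * dist x y ∈ Set.Icc 0 (dist x y) := ⟨by positivity, mul_le_of_le_one_left hd h1⟩
  refine ⟨γ (t * dist x y), ?_, ?_⟩
  · have := hγ _ m0 _ mt
    rw [e0, zero_sub, abs_neg, abs_of_nonneg mt.1] at this
    exact this
  · have := hγ _ mt _ m1
    rw [e1, abs_sub_comm, abs_of_nonneg (sub_nonneg.2 mt.2)] at this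
    rw [this]; ring

/-- Comparison triangles exist. -/
theorem exists_comparison_triangle (x y z : X) : ∃ x' y' z' : EuclideanSpace ℝ (Fin 2),
    dist x' y' = dist x y ∧ dist y' z' = dist y z ∧ dist x' z' = dist x z := by
  have ha := dist_nonneg (x := x) (y := y)
  have hb := dist_nonneg (x := y) (y := z)
  have hc := dist_nonneg (x := x) (y := z)
  have t1 := dist_triangle x y z
  have t2 := dist_triangle y x z
  have t3 := dist_triangle x z y
  rw [dist_comm y x] at t2
  rw [dist_comm z y] at t3
  generalize dist x y = a at *
  generalize dist y z = b at *
  generalize dist x z = c at *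
  rcases eq_or_lt_of_le ha with h0 | h0
  · have hbc : b = c := by linarith
    refine ⟨!₂[0, 0], !₂[0, 0], !₂[c, 0], ?_, ?_, ?_⟩ <;>
      simp [EuclideanSpace.dist_eq, Real.dist_eq, Real.sqrt_sq, hc, ← h0, hbc]
  -- The law of cosines gives the abscissa `w` of the third vertex.
  · set w := (a ^ 2 + c ^ 2 - b ^ 2) / (2 * a) with hw
    have hw' : 2 * a * w = a ^ 2 + c ^ 2 - b ^ 2 := by rw [hw]; field_simp
    have hv : 0 ≤ c ^ 2 - w ^ 2 := by
      have l1 : w ≤ c := by rw [hw, div_le_iff₀ (by positivity)]; nlinarith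
      have l2 : -c ≤ w := by rw [hw, le_div_iff₀ (by positivity)]; nlinarith
      nlinarith
    have hs := Real.sq_sqrt hv
    refine ⟨!₂[0, 0], !₂[a, 0], !₂[w, √(c ^ 2 - w ^ 2)], ?_, ?_, ?_⟩
    · simp [EuclideanSpace.dist_eq, Real.dist_eq, Real.sqrt_sq, ha]
    · rw [EuclideanSpace.dist_eq, Real.sqrt_eq_iff_mul_self_eq (by positivity) hb]
      simp only [Fin.sum_univ_two, Real.dist_eq, sq_abs]
      simp
      nlinarith
    · rw [EuclideanSpace.dist_eq, Real.sqrt_eq_iff_mul_self_eq (by positivity) hc]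
      simp only [Fin.sum_univ_two, Real.dist_eq, sq_abs]
      simp
      nlinarith

theorem IsCAT0.dist_isAt_le (hX : IsCAT0 X) {x y z p q : X} {t : ℝ} (h0 : 0 ≤ t) (h1 : t ≤ 1)
    (hp : IsAt x y t p) (hq : IsAt x z t q) : dist p q ≤ t * dist y z := by
  obtain ⟨x', y', z', e1, e2, e3⟩ := exists_comparison_triangle x y z
  have h1' : 0 ≤ 1 - t := by linarith
  refine (hX.comparison x y z p q x' y' z' (AffineMap.lineMap x' y' t) (AffineMap.lineMap x' z' t)
    e1 e2 e3 hp.add ?_ ?_ hq.add ?_ ?_).trans_eq ?_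
  · rw [dist_left_lineMap, hp.left, e1, Real.norm_of_nonneg h0]
  · rw [dist_lineMap_right, hp.right, e1, Real.norm_of_nonneg h1']
  · rw [dist_left_lineMap, hq.left, e3, Real.norm_of_nonneg h0]
  · rw [dist_lineMap_right, hq.right, e3, Real.norm_of_nonneg h1']
  · have : (AffineMap.lineMap x' y' t : EuclideanSpace ℝ (Fin 2)) -
        (AffineMap.lineMap x' z' t : EuclideanSpace ℝ (Fin 2)) = t • (y' - z') := by
      simp only [AffineMap.lineMap_apply_module]
      module
    rw [dist_eq_norm, this, norm_smul, ← dist_eq_norm, e2, Real.norm_of_nonneg h0]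

/-- The distance of a CAT(0) space is convex. -/
theorem IsCAT0.dist_convex (hX : IsCAT0 X) {x y x' y' p p' : X} {t : ℝ} (h0 : 0 ≤ t) (h1 : t ≤ 1)
    (hp : IsAt x y t p) (hp' : IsAt x' y' t p') :
    dist p p' ≤ (1 - t) * dist x x' + t * dist y y' := by
  obtain ⟨q, hq⟩ := hX.exists_isAt x y' h0 h1
  have l1 := hX.dist_isAt_le h0 h1 hp hq
  have l2 := hX.dist_isAt_le (by linarith) (by linarith) hq.symm hp'.symm
  linarith [dist_triangle p q p']

/-- The inequality of Bruhat and Tits. -/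
theorem IsCAT0.dist_sq_midpoint_le (hX : IsCAT0 X) {x y m : X} (hm : IsAt x y (1 / 2) m) (z : X) :
    dist z m ^ 2 ≤ (dist z x ^ 2 + dist z y ^ 2) / 2 - dist x y ^ 2 / 4 := by
  obtain ⟨x', y', z', e1, e2, e3⟩ := exists_comparison_triangle x y z
  have key := hX.comparison x y z m z x' y' z' (AffineMap.lineMap x' y' (1 / 2 : ℝ)) z'
    e1 e2 e3 hm.add
    (by rw [dist_left_lineMap, hm.left, e1, Real.norm_of_nonneg (by norm_num)])
    (by rw [dist_lineMap_right, hm.right, e1, Real.norm_of_nonneg (by norm_num)])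
    (by rw [dist_self, add_zero]) e3 (by rw [dist_self, dist_self])
  have par := parallelogram_law_with_norm ℝ (x' - z') (y' - z')
  have hmid : (AffineMap.lineMap x' y' (1 / 2 : ℝ) : EuclideanSpace ℝ (Fin 2)) - z' =
      (1 / 2 : ℝ) • ((x' - z') + (y' - z')) := by
    simp only [AffineMap.lineMap_apply_module]
    module
  rw [dist_eq_norm (AffineMap.lineMap x' y' (1 / 2 : ℝ)), hmid, norm_smul,
    Real.norm_of_nonneg (by norm_num)] at key
  rw [sub_sub_sub_cancel_right, ← dist_eq_norm x' y', ← dist_eq_norm x' z', ← dist_eq_norm y' z',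
    e1, e2, e3] at par
  rw [dist_comm z x, dist_comm z y, dist_comm z m]
  have := pow_le_pow_left₀ dist_nonneg key 2
  nlinarith

/-- Apply the Bruhat–Tits inequality at `q` and at `s` to the midpoint `m` of `p` and `r`, and bound
`dist q s` by the path through `m`. -/
theorem IsCAT0.quadrilateral (hX : IsCAT0 X) (p q r s : X) :
    dist p r ^ 2 + dist q s ^ 2 ≤
      dist p q ^ 2 + dist q r ^ 2 + dist r s ^ 2 + dist s p ^ 2 := by
  obtain ⟨m, hm⟩ := hX.exists_isAt p r (t := 1 / 2) (by norm_num) (by norm_num)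
  have h1 := hX.dist_sq_midpoint_le hm q
  have h2 := hX.dist_sq_midpoint_le hm s
  have h3 := pow_le_pow_left₀ dist_nonneg (dist_triangle q m s) 2
  rw [dist_comm m s] at h3
  rw [dist_comm p q, dist_comm r s]
  nlinarith [sq_nonneg (dist q m - dist s m)]

/-- Real functions that are convex along geodesics. -/
def ConvexFn (f : X → ℝ) : Prop :=
  ∀ (x y z : X) (t : ℝ), 0 ≤ t → t ≤ 1 → IsAt x y t z → f z ≤ (1 - t) * f x + t * f y

/-- Real functions that are affine along geodesics. -/
def AffineFn (f : X → ℝ) : Prop :=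
  ∀ (x y z : X) (t : ℝ), 0 ≤ t → t ≤ 1 → IsAt x y t z → f z = (1 - t) * f x + t * f y

theorem AffineFn.neg {f : X → ℝ} (hf : AffineFn f) : AffineFn (fun x => -f x) :=
  fun x y z t h0 h1 h => by linarith [hf x y z t h0 h1 h]

theorem continuous_of_sub_le {f : X → ℝ} {L : ℝ} (hf : ∀ x y, f x - f y ≤ L * dist x y) :
    Continuous f :=
  (LipschitzWith.of_le_add_mul' L fun x y => by linarith [hf x y]).continuous

/-- A convex function on a half-line with sublinear growth never exceeds its initial value: here
`b`, `a`, `e n` are its values at times `0`, `t`, `n * t`. -/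
theorem le_of_sublinear {a b : ℝ} {e : ℕ → ℝ}
    (h : ∀ n : ℕ, 0 < n → a ≤ (1 - 1 / (n : ℝ)) * b + 1 / (n : ℝ) * e n)
    (he : Tendsto (fun n : ℕ => e n / n) atTop (𝓝 0)) : a ≤ b := by
  have h1 : Tendsto (fun n : ℕ => (1 - 1 / (n : ℝ)) * b + e n / n) atTop
      (𝓝 ((1 - 0) * b + 0)) :=
    ((tendsto_const_nhds.sub tendsto_one_div_atTop_nhds_zero_nat).mul_const b).add he
  rw [sub_zero, one_mul, add_zero] at h1
  refine ge_of_tendsto h1 ?_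
  filter_upwards [eventually_gt_atTop 0] with n hn
  have := h n hn
  rwa [one_div_mul_eq_div] at this

theorem tendsto_div_zero_of_sq_le {e : ℕ → ℝ}
    (h : ∀ ε > 0, ∀ᶠ n : ℕ in atTop, (e n / n) ^ 2 ≤ ε) :
    Tendsto (fun n : ℕ => e n / n) atTop (𝓝 0) := by
  rw [Metric.tendsto_nhds]
  intro ε hε
  filter_upwards [h ((ε / 2) ^ 2) (by positivity)] with n hn
  rw [Real.dist_eq, sub_zero]
  have := abs_le_of_sq_le_sq hn (by positivity)
  linarith

end Geometry

/-! ### Rays of steepest descent of a convex function -/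

section Slope

variable {X : Type u} [MetricSpace X]

theorem GeodesicRay.isAt (c : GeodesicRay X) (t : ℝ≥0) {n : ℕ} (hn : 0 < n) :
    IsAt (c.1 0) (c.1 (n * t)) (1 / (n : ℝ)) (c.1 t) := by
  have hn' : (1 : ℝ) ≤ n := by exact_mod_cast hn
  have hn0 : (n : ℝ) ≠ 0 := by positivity
  constructor
  · rw [c.2.dist_eq, c.2.dist_eq, NNReal.dist_eq, NNReal.dist_eq]
    push_cast
    rw [zero_sub, zero_sub, abs_neg, abs_neg, abs_of_nonneg (by positivity),
      abs_of_nonneg (by positivity)]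
    field_simp
  · rw [c.2.dist_eq, c.2.dist_eq, NNReal.dist_eq, NNReal.dist_eq]
    push_cast
    have : (t : ℝ) ≤ n * t := le_mul_of_one_le_left t.2 hn'
    rw [zero_sub, abs_neg, abs_sub_comm, abs_of_nonneg (by linarith : (0 : ℝ) ≤ n * t - t),
      abs_of_nonneg (by positivity)]
    field_simp

/-- Two rays at sublinear distance are asymptotic. -/
theorem asymptotic_of_sublinear (hX : IsCAT0 X) (c c' : GeodesicRay X)
    (h : ∀ t : ℝ≥0, 0 < t →
      Tendsto (fun n : ℕ => dist (c.1 (n * t)) (c'.1 (n * t)) / n) atTop (𝓝 0)) :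
    c ≈ c' := by
  refine ⟨dist (c.1 0) (c'.1 0), fun t => ?_⟩
  rcases eq_or_lt_of_le (zero_le (a := t)) with rfl | ht
  · rfl
  · refine le_of_sublinear (fun n hn => ?_) (h t ht)
    have hn' : (1 : ℝ) ≤ n := by exact_mod_cast hn
    refine hX.dist_convex (by positivity) ?_ (c.isAt t hn) (c'.isAt t hn)
    rw [div_le_one (by positivity)]; exact hn'

/-- Rays along which a convex function decreases at the largest possible asymptotic rate are
asymptotic to each other. -/
theorem asymptotic_of_steepest (hX : IsCAT0 X) {F : X → ℝ} (hF : ConvexFn F) {L : ℝ}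
    (hL : ∀ x y, F x - F y ≤ L * dist x y) {o : X} {a : ℝ} (ha : 0 < a)
    (hrate : ∀ ε > 0, ∃ r, ∀ y, r ≤ dist o y → -F y ≤ (a + ε) * dist o y)
    (c c' : GeodesicRay X) {K : ℝ} (hc : ∀ t, F (c.1 t) ≤ K - a * t)
    (hc' : ∀ t, F (c'.1 t) ≤ K - a * t) : c ≈ c' := by
  refine asymptotic_of_sublinear hX c c' fun t ht => tendsto_div_zero_of_sq_le fun η hη => ?_
  have ht' : (0 : ℝ) < t := ht
  -- The quantity on the left dominates the limit `4 * (t² - (a * t / (a + ε))²)` of the bound on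
  -- the squared distance obtained below.
  obtain ⟨ε, hε, hεη⟩ : ∃ ε > 0, 8 * (t : ℝ) ^ 2 * ε / a < η :=
    ⟨η * a / (16 * (t : ℝ) ^ 2), by positivity, by field_simp; norm_num⟩
  obtain ⟨r, hr⟩ := hrate ε hε
  set D := max (dist o (c.1 0)) (dist o (c'.1 0)) with hD
  have hL0 : 0 < L := by
    by_contra! hL0
    obtain ⟨n, hn⟩ := exists_nat_gt ((K - F (c.1 0)) / a)
    rw [div_lt_iff₀ ha] at hn
    have h1 := hc n
    have h2 := hL (c.1 0) (c.1 n)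
    have h3 := mul_nonpos_of_nonpos_of_nonneg hL0 (dist_nonneg (x := c.1 0) (y := c.1 n))
    simp only [NNReal.coe_natCast] at h1
    linarith
  have lim1 : Tendsto (fun n : ℕ => 4 * ((t + D * (1 / (n : ℝ))) ^ 2 -
      ((a * t - K * (1 / (n : ℝ))) / (a + ε)) ^ 2)) atTop
      (𝓝 (4 * ((t + D * 0) ^ 2 - ((a * t - K * 0) / (a + ε)) ^ 2))) := by
    have := tendsto_one_div_atTop_nhds_zero_nat (𝕜 := ℝ)
    exact (((tendsto_const_nhds.add (this.const_mul D)).pow 2).sub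
      (((tendsto_const_nhds.sub (this.const_mul K)).div_const _).pow 2)).const_mul 4
  have hlt : 4 * ((t + D * 0) ^ 2 - ((a * t - K * 0) / (a + ε)) ^ 2) < η := by
    refine lt_of_le_of_lt ?_ hεη
    rw [mul_zero, mul_zero, add_zero, sub_zero, div_pow, le_div_iff₀ ha]
    have hae : 0 < a + ε := by positivity
    have e : 4 * ((t : ℝ) ^ 2 - (a * t) ^ 2 / (a + ε) ^ 2) * a =
        4 * t ^ 2 * a * (2 * a * ε + ε ^ 2) / (a + ε) ^ 2 := by field_simp; ring
    rw [e, div_le_iff₀ (by positivity)]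
    have h4 : 0 ≤ (t : ℝ) ^ 2 * ε * (a * ε * 3 + 2 * ε ^ 2) := by positivity
    nlinarith
  have ev2 : ∀ᶠ n : ℕ in atTop, K + |F o| + L * r < n * (a * t) ∧ K < n * (a * t) := by
    have : Tendsto (fun n : ℕ => (n : ℝ) * (a * t)) atTop atTop :=
      tendsto_natCast_atTop_atTop.atTop_mul_const (by positivity)
    exact (this.eventually_gt_atTop _).and (this.eventually_gt_atTop _)
  filter_upwards [lim1.eventually_lt_const hlt, ev2, eventually_gt_atTop 0] with n hn1 hn2 hn0
  have hn0' : (0 : ℝ) < n := by exact_mod_cast hn0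
  refine le_trans ?_ hn1.le
  -- By convexity `F` is as low at the midpoint as required of the endpoints, so the rate bound
  -- forces `m` far from `o`. The endpoints are not much farther away, so Bruhat–Tits makes them
  -- close to each other.
  obtain ⟨m, hm⟩ := hX.exists_isAt (c.1 (n * t)) (c'.1 (n * t)) (t := 1 / 2)
    (by norm_num) (by norm_num)
  have hcn : F (c.1 (n * t)) ≤ K - a * (n * t) := by simpa using hc (n * t)
  have hcn' : F (c'.1 (n * t)) ≤ K - a * (n * t) := by simpa using hc' (n * t)
  have hFm : F m ≤ K - n * (a * t) := by
    have := hF _ _ _ _ (by norm_num) (by norm_num) hm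
    linarith
  have hdr : r ≤ dist o m := by
    have := hL o m
    have h2 := neg_abs_le (F o)
    by_contra! hlt
    nlinarith
  have hdm : (n * (a * t) - K) / (a + ε) ≤ dist o m := by
    rw [div_le_iff₀ (by positivity)]
    linarith [hr m hdr]
  have hray : ∀ b : GeodesicRay X, dist o (b.1 (n * t)) ≤ dist o (b.1 0) + n * t := by
    intro b
    refine (dist_triangle _ (b.1 0) _).trans_eq ?_
    rw [b.2.dist_eq, NNReal.dist_eq, NNReal.coe_zero, zero_sub, abs_neg, NNReal.abs_eq]
    simp
  have b1 : dist o (c.1 (n * t)) ≤ n * t + D := by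
    linarith [hray c, le_max_left (dist o (c.1 0)) (dist o (c'.1 0))]
  have b2 : dist o (c'.1 (n * t)) ≤ n * t + D := by
    linarith [hray c', le_max_right (dist o (c.1 0)) (dist o (c'.1 0))]
  have cn := hX.dist_sq_midpoint_le hm o
  have q1 := pow_le_pow_left₀ dist_nonneg b1 2
  have q2 := pow_le_pow_left₀ dist_nonneg b2 2
  have q3 := pow_le_pow_left₀ (div_nonneg (by linarith) (by positivity)) hdm 2
  have fin : dist (c.1 (n * t)) (c'.1 (n * t)) ^ 2 ≤
      4 * ((n * t + D) ^ 2 - ((n * (a * t) - K) / (a + ε)) ^ 2) := by linarith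
  rw [div_pow, div_le_iff₀ (by positivity)]
  refine fin.trans_eq ?_
  field_simp

/-- The asymptotic slope of a function that is unbounded below at a linear rate. -/
theorem exists_steepest_rate {F : X → ℝ} {L : ℝ} (hL : ∀ x y, F x - F y ≤ L * dist x y) {o : X}
    (ho : F o = 0) {k d : ℝ} (hk : 0 < k) {y : ℕ → X} (hy : ∀ n, F (y n) = -(n * k))
    (hd : ∀ n, dist o (y n) ≤ n * d) : ∃ a > 0,
      (∀ ε > 0, ∃ r, ∀ y, r ≤ dist o y → -F y ≤ (a + ε) * dist o y) ∧
      (∀ ε > 0, ∀ r, ∃ y, r ≤ dist o y ∧ (a - ε) * dist o y < -F y) := by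
  -- The infimum of `S` is the upper limit of `-F y / dist o y` as `y` goes to infinity; the points
  -- `y n` bound it below by `k / d`.
  set S : Set ℝ := {s | ∃ r, ∀ y, r ≤ dist o y → -F y ≤ s * dist o y} with hS
  have hne : S.Nonempty := ⟨L, 0, fun y _ => by linarith [hL o y]⟩
  have hk1 : k ≤ L * dist o (y 1) := by
    have := hL o (y 1)
    rw [hy, ho] at this
    push_cast at this
    linarith
  have hL0 : 0 < L := by
    by_contra! h
    nlinarith [dist_nonneg (x := o) (y := y 1)]
  have hd0 : 0 < d := by
    have := hd 1
    push_cast at this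
    nlinarith
  have hlow : ∀ s ∈ S, k / d ≤ s := by
    rintro s ⟨r, hr⟩
    rw [div_le_iff₀ hd0]
    obtain ⟨n, hn⟩ := exists_nat_gt (max (L * r / k) 0)
    have hn0 : (0 : ℝ) < n := (le_max_right _ _).trans_lt hn
    have hn1 := (le_max_left _ _).trans_lt hn
    rw [div_lt_iff₀ hk] at hn1
    have h1 := hL o (y n)
    rw [hy, ho] at h1
    have h2 := hr (y n) (by by_contra! hlt; nlinarith)
    rw [hy] at h2
    have hs : 0 < s := by
      by_contra! hs
      have := mul_nonpos_of_nonpos_of_nonneg hs (dist_nonneg (x := o) (y := y n))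
      nlinarith
    have h3 := mul_le_mul_of_nonneg_left (hd n) hs.le
    have h4 : (n : ℝ) * k ≤ n * (s * d) := by linarith
    exact le_of_mul_le_mul_left h4 hn0
  have hbdd : BddBelow S := ⟨_, hlow⟩
  refine ⟨sInf S, (div_pos hk hd0).trans_le (le_csInf hne hlow), fun ε hε => ?_, fun ε hε r => ?_⟩
  · obtain ⟨s, ⟨r, hr⟩, hs⟩ := exists_lt_of_csInf_lt hne (lt_add_of_pos_right (sInf S) hε)
    exact ⟨r, fun y hy => (hr y hy).trans (mul_le_mul_of_nonneg_right hs.le dist_nonneg)⟩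
  · by_contra! h
    have : sInf S ≤ sInf S - ε := csInf_le hbdd ⟨r, h⟩
    linarith

/-- Segments from `o` to distant points of nearly optimal slope converge to a ray by properness.
Convexity carries the slope at the far end to the whole segment. Limits along one ultrafilter handle
all times at once. -/
theorem exists_steepest_ray [ProperSpace X] (hX : IsCAT0 X) {F : X → ℝ} (hF : ConvexFn F)
    (hcont : Continuous F) {o : X} (ho : F o = 0) {a : ℝ}
    (hsup : ∀ ε > 0, ∀ r, ∃ y, r ≤ dist o y ∧ (a - ε) * dist o y < -F y) :
    ∃ c : GeodesicRay X, ∀ t, F (c.1 t) ≤ -(a * t) := by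
  choose y hy1 hy2 using fun n : ℕ => hsup (1 / ((n : ℝ) + 1)) (by positivity) ((n : ℝ) + 1)
  choose γ hγ0 hγ1 hγ using fun n : ℕ => hX.geodesic o (y n)
  have hmem : ∀ (s : ℝ≥0) (n : ℕ), (s : ℝ) ≤ n → (s : ℝ) ∈ Set.Icc 0 (dist o (y n)) :=
    fun s n hn => ⟨s.2, by linarith [hy1 n]⟩
  have hev : ∀ s : ℝ≥0, ∀ᶠ n : ℕ in (hyperfilter ℕ : Filter ℕ), (s : ℝ) ≤ n := by
    intro s
    refine Filter.Eventually.filter_mono (Nat.hyperfilter_le_atTop) ?_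
    exact tendsto_natCast_atTop_atTop.eventually_ge_atTop _
  have hdist : ∀ (s : ℝ≥0) (n : ℕ), (s : ℝ) ≤ n → dist o (γ n s) = s := by
    intro s n hn
    have := hγ n 0 ⟨le_rfl, dist_nonneg⟩ s (hmem s n hn)
    rwa [hγ0, zero_sub, abs_neg, NNReal.abs_eq] at this
  have hlim : ∀ s : ℝ≥0, ∃ x, Tendsto (fun n => γ n s) (hyperfilter ℕ : Filter ℕ) (𝓝 x) := by
    intro s
    obtain ⟨x, -, hx⟩ := (isCompact_closedBall o (s : ℝ)).ultrafilter_le_nhds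
      ((hyperfilter ℕ).map fun n => γ n s) (by
        rw [le_principal_iff, Ultrafilter.coe_map, mem_map]
        filter_upwards [hev s] with n hn
        rw [Set.mem_preimage, Metric.mem_closedBall, dist_comm, hdist s n hn])
    exact ⟨x, hx⟩
  choose c hc using hlim
  refine ⟨⟨c, Isometry.of_dist_eq fun s t => ?_⟩, fun t => ?_⟩
  · refine tendsto_nhds_unique ((hc s).dist (hc t)) (tendsto_const_nhds.congr' ?_)
    filter_upwards [hev s, hev t] with n hs ht
    rw [hγ n s (hmem s n hs) t (hmem t n ht), NNReal.dist_eq]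
  · have l1 : Tendsto (fun n : ℕ => -((a - 1 / ((n : ℝ) + 1)) * t)) (hyperfilter ℕ : Filter ℕ)
        (𝓝 (-((a - 0) * t))) :=
      (((tendsto_const_nhds.sub tendsto_one_div_add_atTop_nhds_zero_nat).mul_const _).neg).mono_left
        Nat.hyperfilter_le_atTop
    rw [sub_zero] at l1
    refine le_of_tendsto_of_tendsto ((hcont.tendsto _).comp (hc t)) l1 ?_
    filter_upwards [hev t] with n hn
    have hpos : 0 < dist o (y n) := lt_of_lt_of_le (by positivity) (hy1 n)
    have hat : IsAt o (y n) (t / dist o (y n)) (γ n t) := by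
      have h2 := hγ n t (hmem t n hn) _ ⟨dist_nonneg, le_rfl⟩
      rw [hγ1, abs_sub_comm, abs_of_nonneg (sub_nonneg.2 (hmem t n hn).2)] at h2
      constructor
      · rw [hdist t n hn]; field_simp
      · rw [h2]; field_simp
    have := hF _ _ _ _ (by positivity) ((div_le_one hpos).2 (hmem t n hn).2) hat
    rw [ho, mul_zero, zero_add] at this
    refine this.trans ?_
    have h3 := mul_le_mul_of_nonneg_left (hy2 n).le (show 0 ≤ (t : ℝ) / dist o (y n) by positivity)
    have e : (t : ℝ) / dist o (y n) * ((a - 1 / ((n : ℝ) + 1)) * dist o (y n)) =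
      (a - 1 / ((n : ℝ) + 1)) * t := by field_simp
    rw [e] at h3
    linarith

end Slope

/-! ### Quasi-invariant functions under the full group -/

section Action

variable {X : Type u} [MetricSpace X] [ProperSpace X] {G : Type v} [Group G] [MulAction G X]
  [IsIsometricSMul G X]

/-- The orbit of `o` under powers of `h` gives a positive descent rate. Quasi-invariance sends a
steepest ray to a steepest ray, and these are all asymptotic. -/
theorem hasFixedPointAtInfinity_of_translation (hX : IsCAT0 X) {F : X → ℝ} (hF : ConvexFn F)
    {L : ℝ} (hL : ∀ x y, F x - F y ≤ L * dist x y)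
    (hq : ∀ g : G, ∃ k : ℝ, ∀ x, F (g • x) = F x + k) {o : X} (ho : F o = 0) {h : G} {k : ℝ}
    (hk : 0 < k) (hh : ∀ x, F (h • x) = F x - k) : HasFixedPointAtInfinity G X := by
  have hy : ∀ n : ℕ, F (h ^ n • o) = -(n * k) := by
    intro n
    induction n with
    | zero => simp [ho]
    | succ n ih => rw [pow_succ', mul_smul, hh, ih]; push_cast; ring
  have hd : ∀ n : ℕ, dist o (h ^ n • o) ≤ n * dist o (h • o) := by
    intro n
    induction n with
    | zero => simp
    | succ n ih =>
      refine (dist_triangle _ (h ^ n • o) _).trans ?_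
      rw [pow_succ, mul_smul, dist_smul]
      push_cast
      linarith
  obtain ⟨a, ha, hrate, hsup⟩ := exists_steepest_rate hL ho hk hy hd
  obtain ⟨c, hc⟩ := exists_steepest_ray hX hF (continuous_of_sub_le hL) ho hsup
  refine ⟨Quotient.mk _ c, fun g => ?_⟩
  obtain ⟨κ, hκ⟩ := hq g
  refine Quotient.sound (asymptotic_of_steepest hX hF hL ha hrate
    (⟨fun t => g • c.1 t, (isometry_smul X g).comp c.2⟩ : GeodesicRay X) c (K := max 0 κ)
    (fun t => ?_) fun t => ?_)
  · show F (g • c.1 t) ≤ _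
    rw [hκ]
    linarith [hc t, le_max_right 0 κ]
  · linarith [hc t, le_max_left 0 κ]

/-- A quasi-invariant convex Lipschitz function is constant if the action is minimal and fixes no
point at infinity. -/
theorem quasiInvariant_const (hX : IsCAT0 X) (hmin : ActsMinimally G X)
    (hfix : ¬ HasFixedPointAtInfinity G X) {F : X → ℝ} (hF : ConvexFn F)
    {L : ℝ} (hL : ∀ x y, F x - F y ≤ L * dist x y)
    (hq : ∀ g : G, ∃ k : ℝ, ∀ x, F (g • x) = F x + k) (x y : X) : F x = F y := by
  have key : ∀ (g : G) (k : ℝ), (∀ x, F (g • x) = F x + k) → 0 ≤ k := by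
    intro g k hk
    by_contra! hneg
    refine hfix (hasFixedPointAtInfinity_of_translation (F := fun z => F z - F x) (L := L) (o := x)
      (h := g) (k := -k) hX ?_ ?_ ?_ (sub_self _) (by linarith) ?_)
    · intro x y z t h0 h1 h
      linarith [hF x y z t h0 h1 h]
    · intro x y; linarith [hL x y]
    · intro g
      obtain ⟨k, hk⟩ := hq g
      exact ⟨k, fun x => by rw [hk]; ring⟩
    · intro x; rw [hk]; ring
  have hinv : ∀ (g : G) x, F (g • x) = F x := by
    intro g x
    obtain ⟨k, hk⟩ := hq g
    have h1 := key g k hk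
    have h2 := key g⁻¹ (-k) fun x => by
      have := hk (g⁻¹ • x)
      rw [smul_inv_smul] at this
      linarith
    rw [hk]; linarith
  have hsub : ∀ x y, F y ≤ F x := by
    intro x
    have : {z | F z ≤ F x} = Set.univ := by
      refine hmin _ ⟨x, le_refl (F x)⟩ (isClosed_le (continuous_of_sub_le hL) continuous_const) ?_ ?_
      · intro p hp q hq z hz
        obtain ⟨t, h0, h1, ht⟩ := exists_isAt_of_add hz
        have := hF p q z t h0 h1 ht
        simp only [Set.mem_ofPred_eq] at hp hq ⊢
        nlinarith
      · intro g z hz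
        simpa only [Set.mem_ofPred_eq, hinv] using hz
    intro y
    have hy : y ∈ {z | F z ≤ F x} := this ▸ Set.mem_univ y
    exact hy
  exact le_antisymm (hsub y x) (hsub x y)

end Action

/-! ### Averaging over the coset space -/

section Averaging

variable {X : Type u} {G : Type v} [Group G] [MulAction G X]

/-- The variation between `x` and `y` of the translates of a quasi-invariant function. -/
def cosetVariation (Γ : Subgroup G) (f : X → ℝ)
    (hq : ∀ γ ∈ Γ, ∃ k : ℝ, ∀ x, f (γ • x) = f x + k) (x y : X) : G ⧸ Γ → ℝ :=
  Quotient.lift (fun g : G => f (g⁻¹ • x) - f (g⁻¹ • y)) fun g h hgh => by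
    obtain ⟨k, hk⟩ := hq _ (QuotientGroup.leftRel_apply.1 hgh)
    have hx := hk (h⁻¹ • x)
    have hy := hk (h⁻¹ • y)
    simp only [smul_smul, mul_assoc, mul_inv_cancel, mul_one] at hx hy
    simp only [hx, hy]
    ring

theorem cosetVariation_mk (Γ : Subgroup G) (f : X → ℝ)
    (hq : ∀ γ ∈ Γ, ∃ k : ℝ, ∀ x, f (γ • x) = f x + k) (x y : X) (g : G) :
    cosetVariation Γ f hq x y (g : G ⧸ Γ) = f (g⁻¹ • x) - f (g⁻¹ • y) := rfl

variable [MetricSpace X]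

theorem continuous_cosetVariation [TopologicalSpace G] [IsTopologicalGroup G] [ContinuousSMul G X] (Γ : Subgroup G)
    {f : X → ℝ} (hf : Continuous f)
    (hq : ∀ γ ∈ Γ, ∃ k : ℝ, ∀ x, f (γ • x) = f x + k) (x y : X) :
    Continuous (cosetVariation Γ f hq x y) := by
  refine continuous_quot_lift _ ?_
  fun_prop

theorem abs_cosetVariation_le [IsIsometricSMul G X] (Γ : Subgroup G) {f : X → ℝ} {L : ℝ}
    (hL : ∀ x y, f x - f y ≤ L * dist x y)
    (hq : ∀ γ ∈ Γ, ∃ k : ℝ, ∀ x, f (γ • x) = f x + k) (x y : X) (p : G ⧸ Γ) :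
    |cosetVariation Γ f hq x y p| ≤ L * dist x y := by
  induction p using QuotientGroup.induction_on with
  | H g =>
    rw [cosetVariation_mk, abs_le]
    have h1 := hL (g⁻¹ • x) (g⁻¹ • y)
    have h2 := hL (g⁻¹ • y) (g⁻¹ • x)
    rw [dist_smul] at h1 h2
    rw [dist_comm] at h2
    constructor <;> linarith

theorem convexFn_infDist (hX : IsCAT0 X) {C : Set X} (hne : C.Nonempty)
    (hC : IsGeodesicallyConvex C) : ConvexFn fun x => Metric.infDist x C := by
  intro x y z t h0 h1 hz
  refine le_of_forall_pos_lt_add fun ε hε => ?_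
  obtain ⟨p, hp, hxp⟩ := (Metric.infDist_lt_iff (r := Metric.infDist x C + ε) hne).1 (by linarith)
  obtain ⟨q, hq, hyq⟩ := (Metric.infDist_lt_iff (r := Metric.infDist y C + ε) hne).1 (by linarith)
  obtain ⟨r, hr⟩ := hX.exists_isAt p q h0 h1
  have e1 := Metric.infDist_le_dist_of_mem (x := z) (hC p hp q hq r hr.add)
  have e2 := hX.dist_convex h0 h1 hz hr
  rcases eq_or_lt_of_le h0 with rfl | h0'
  · linarith
  · nlinarith

variable [IsIsometricSMul G X] [TopologicalSpace G] [IsTopologicalGroup G] [ContinuousSMul G X]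
  [ProperSpace X]

/-- A convex Lipschitz function that is quasi-invariant under a subgroup of finite invariant
covolume is affine. -/
theorem affineFn_of_quasiInvariant (hX : IsCAT0 X) (hmin : ActsMinimally G X)
    (hfix : ¬ HasFixedPointAtInfinity G X) {Γ : Subgroup G} (hΓ : HasFiniteInvariantCovolume Γ)
    {f : X → ℝ} (hf : ConvexFn f) {L : ℝ} (hL : ∀ x y, f x - f y ≤ L * dist x y)
    (hq : ∀ γ ∈ Γ, ∃ k : ℝ, ∀ x, f (γ • x) = f x + k) : AffineFn f := by
  let _ : MeasurableSpace (G ⧸ Γ) := borel (G ⧸ Γ)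
  have : BorelSpace (G ⧸ Γ) := ⟨rfl⟩
  obtain ⟨μ, hμ0, hfin, hreg, hinv⟩ := hΓ
  -- Full support is what later upgrades almost everywhere vanishing of a continuous function to
  -- vanishing at the identity coset.
  have : μ.IsOpenPosMeasure :=
    ⟨fun U hU hne => (measure_isOpen_pos_of_smulInvariant_of_ne_zero G hμ0 hU hne).ne'⟩
  have hcont := continuous_of_sub_le hL
  have hcV := continuous_cosetVariation Γ hcont hq
  have hint : ∀ x y, Integrable (cosetVariation Γ f hq x y) μ := fun x y =>
    Integrable.of_bound (hcV x y).aestronglyMeasurable (L * dist x y)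
      (ae_of_all _ (abs_cosetVariation_le Γ hL hq x y))
  intro x y z t h0 h1 hz
  set F : X → ℝ := fun w => ∫ p, cosetVariation Γ f hq w x p ∂μ with hFdef
  have hsubF : ∀ w w', F w - F w' = ∫ p, cosetVariation Γ f hq w w' p ∂μ := by
    intro w w'
    rw [hFdef, ← integral_sub (hint _ _) (hint _ _)]
    refine integral_congr_ae (ae_of_all _ fun p => ?_)
    induction p using QuotientGroup.induction_on with
    | H g => simp only [cosetVariation_mk]; ring
  have hdefect : ∀ (x y z : X) (t : ℝ), 0 ≤ t → t ≤ 1 → IsAt x y t z → ∀ p : G ⧸ Γ,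
      0 ≤ t * cosetVariation Γ f hq y x p - cosetVariation Γ f hq z x p := by
    intro x y z t h0 h1 hz p
    induction p using QuotientGroup.induction_on with
    | H g =>
      simp only [cosetVariation_mk]
      linarith [hf _ _ _ t h0 h1 (hz.smul g⁻¹)]
  have hintd : ∀ (x y z : X) (t : ℝ), Integrable
      (fun p => t * cosetVariation Γ f hq y x p - cosetVariation Γ f hq z x p) μ :=
    fun x y z t => ((hint y x).const_mul t).sub (hint z x)
  have hFd : ∀ (x y z : X) (t : ℝ),
      ∫ p, (t * cosetVariation Γ f hq y x p - cosetVariation Γ f hq z x p) ∂μ =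
        t * (F y - F x) - (F z - F x) := by
    intro x y z t
    rw [integral_sub ((hint y x).const_mul t) (hint z x), integral_const_mul, hsubF, hsubF]
  have hF : ConvexFn F := by
    intro x y z t h0 h1 hz
    have := integral_nonneg (μ := μ) (f := fun p =>
      t * cosetVariation Γ f hq y x p - cosetVariation Γ f hq z x p) (hdefect x y z t h0 h1 hz)
    rw [hFd] at this
    linarith
  have hFL : ∀ w w', F w - F w' ≤ (L * μ.real Set.univ) * dist w w' := by
    intro w w'
    rw [hsubF]
    have := norm_integral_le_of_norm_le_const (μ := μ) (f := cosetVariation Γ f hq w w')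
      (ae_of_all _ (abs_cosetVariation_le Γ hL hq w w'))
    linarith [le_abs_self (∫ p, cosetVariation Γ f hq w w' p ∂μ),
      Real.norm_eq_abs (∫ p, cosetVariation Γ f hq w w' p ∂μ)]
  have hFq : ∀ h : G, ∃ k : ℝ, ∀ w, F (h • w) = F w + k := by
    intro h
    refine ⟨F (h • x), fun w => ?_⟩
    have e : F (h • w) - F (h • x) = F w := by
      rw [hsubF, ← integral_smul_eq_self (μ := μ) (g := h)]
      refine integral_congr_ae (ae_of_all _ fun p => ?_)
      induction p using QuotientGroup.induction_on with
      | H g =>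
        show cosetVariation Γ f hq _ _ ((h * g : G) : G ⧸ Γ) = _
        simp only [cosetVariation_mk, smul_smul]
        simp
    linarith
  have hconst := quasiInvariant_const hX hmin hfix hF hFL hFq
  have hzero := hFd x y z t
  rw [hconst y x, hconst z x, sub_self, mul_zero, sub_zero] at hzero
  rw [integral_eq_zero_iff_of_nonneg (hdefect x y z t h0 h1 hz) (hintd x y z t)] at hzero
  have heq := (((hcV y x).const_mul t).sub (hcV z x)).ae_eq_iff_eq μ continuous_const |>.1 hzero
  have h2 : t * cosetVariation Γ f hq y x (1 : G) - cosetVariation Γ f hq z x (1 : G) = 0 :=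
    congrFun heq ((1 : G) : G ⧸ Γ)
  simp only [cosetVariation_mk, inv_one, one_smul] at h2
  linarith

/-- A convex Lipschitz function that is invariant under a subgroup of finite invariant covolume
is constant. -/
theorem const_of_invariant (hX : IsCAT0 X) (hmin : ActsMinimally G X)
    (hfix : ¬ HasFixedPointAtInfinity G X) {Γ : Subgroup G} (hΓ : HasFiniteInvariantCovolume Γ)
    {f : X → ℝ} (hf : ConvexFn f) {L : ℝ} (hL : ∀ x y, f x - f y ≤ L * dist x y)
    (hq : ∀ γ ∈ Γ, ∀ x, f (γ • x) = f x) (x y : X) : f x = f y := by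
  have key : ∀ x y, f x ≤ f y := by
    intro x y
    by_contra! hlt
    obtain ⟨m, hm⟩ := hX.exists_isAt x y (t := 1 / 2) (by norm_num) (by norm_num)
    have h1 := affineFn_of_quasiInvariant hX hmin hfix hΓ hf hL
      (fun γ hγ => ⟨0, fun x => by rw [hq γ hγ, add_zero]⟩) _ _ _ _ (by norm_num) (by norm_num) hm
    -- The truncation at height `f m` is again convex, Lipschitz and invariant, hence affine. It
    -- takes the value `f m` at both `m` and `y` but a larger one at `x`.
    have h2 := affineFn_of_quasiInvariant hX hmin hfix hΓ (f := fun w => max (f w) (f m)) (L := L)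
      (fun p q r t h0 h1 h => by
        have e1 := mul_le_mul_of_nonneg_left (le_max_left (f p) (f m)) (sub_nonneg.2 h1)
        have e2 := mul_le_mul_of_nonneg_left (le_max_left (f q) (f m)) h0
        have e3 := mul_le_mul_of_nonneg_left (le_max_right (f p) (f m)) (sub_nonneg.2 h1)
        have e4 := mul_le_mul_of_nonneg_left (le_max_right (f q) (f m)) h0
        refine max_le ?_ ?_
        · linarith [hf p q r t h0 h1 h]
        · linarith)
      (fun p q => by
        have e1 := hL p q
        have e2 := hL q p
        rw [dist_comm] at e2
        rw [sub_le_iff_le_add]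
        refine max_le ?_ ?_
        · linarith [le_max_left (f q) (f m)]
        · linarith [le_max_right (f q) (f m)])
      (fun γ hγ => ⟨0, fun x => by rw [hq γ hγ, add_zero]⟩) _ _ _ _ (by norm_num) (by norm_num) hm
    simp only [max_self] at h2
    rw [max_eq_left (by linarith), max_eq_right (by linarith)] at h2
    linarith
  exact le_antisymm (key x y) (key y x)

theorem actsMinimally_of_finiteCovolume (hX : IsCAT0 X) (hmin : ActsMinimally G X)
    (hfix : ¬ HasFixedPointAtInfinity G X) {Γ : Subgroup G}
    (hΓ : HasFiniteInvariantCovolume Γ) : ActsMinimally Γ X := by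
  intro C hne hcl hC hinv
  have hsmul : ∀ γ ∈ Γ, ∀ x, Metric.infDist (γ • x) C ≤ Metric.infDist x C := by
    intro γ hγ x
    refine (Metric.le_infDist hne).2 fun y hy => ?_
    rw [← dist_smul γ x y]
    exact Metric.infDist_le_dist_of_mem (hinv ⟨γ, hγ⟩ y hy)
  have hconst := const_of_invariant hX hmin hfix hΓ (convexFn_infDist hX hne hC) (L := 1)
    (fun x y => by linarith [Metric.infDist_le_infDist_add_dist (s := C) (x := x) (y := y)])
    (fun γ hγ x => le_antisymm (hsmul γ hγ x) (by
      simpa only [inv_smul_smul] using hsmul γ⁻¹ (Γ.inv_mem hγ) (γ • x)))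
  obtain ⟨c, hc⟩ := hne
  refine Set.eq_univ_of_forall fun x => ?_
  rw [hcl.mem_iff_infDist_zero ⟨c, hc⟩, hconst x c]
  exact Metric.infDist_zero_of_mem hc

end Averaging

/-! ### Busemann functions of asymptotic rays -/

section Busemann

variable {X : Type u} [MetricSpace X]

/-- The Busemann function of a geodesic ray. -/
noncomputable def busemann (c : GeodesicRay X) (x : X) : ℝ :=
  ⨅ n : ℕ, (dist x (c.1 n) - n)

theorem GeodesicRay.dist_natCast (c : GeodesicRay X) {m n : ℕ} (h : m ≤ n) :
    dist (c.1 m) (c.1 n) = n - m := by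
  have : (m : ℝ) ≤ n := by exact_mod_cast h
  rw [c.2.dist_eq, NNReal.dist_eq, abs_sub_comm]
  push_cast
  rw [abs_of_nonneg (by linarith)]

theorem tendsto_busemann (c : GeodesicRay X) (x : X) :
    Tendsto (fun n : ℕ => dist x (c.1 n) - n) atTop (𝓝 (busemann c x)) := by
  refine tendsto_atTop_ciInf (fun m n hmn => ?_) ⟨-dist x (c.1 0), ?_⟩
  · have := c.dist_natCast hmn
    have h2 := dist_triangle x (c.1 m) (c.1 n)
    linarith
  · rintro _ ⟨n, rfl⟩
    have h1 := c.dist_natCast (Nat.zero_le n)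
    have h2 := dist_triangle_left (c.1 0) (c.1 n) x
    rw [dist_comm x (c.1 0)]
    simp only [Nat.cast_zero, sub_zero] at h1
    rw [dist_comm x (c.1 0)] at h2
    linarith

theorem busemann_sub_le (c : GeodesicRay X) (x y : X) :
    busemann c x - busemann c y ≤ 1 * dist x y :=
  le_of_tendsto' ((tendsto_busemann c x).sub (tendsto_busemann c y)) fun n => by
    linarith [dist_triangle x y (c.1 n)]

theorem convexFn_busemann (hX : IsCAT0 X) (c : GeodesicRay X) : ConvexFn (busemann c) := by
  intro x y z t h0 h1 hz
  refine le_of_tendsto_of_tendsto' (tendsto_busemann c z)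
    (((tendsto_busemann c x).const_mul (1 - t)).add ((tendsto_busemann c y).const_mul t))
    fun n => ?_
  have := hX.dist_convex (p' := c.1 n) (x' := c.1 n) (y' := c.1 n) h0 h1 hz
    ⟨by simp, by simp⟩
  linarith

theorem busemann_self (c : GeodesicRay X) (t : ℝ≥0) : busemann c (c.1 t) = -t := by
  refine tendsto_nhds_unique (tendsto_busemann c _) (tendsto_const_nhds.congr' ?_)
  filter_upwards [tendsto_natCast_atTop_atTop.eventually_ge_atTop (t : ℝ)] with n hn
  rw [c.2.dist_eq, NNReal.dist_eq, abs_sub_comm]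
  push_cast
  rw [abs_of_nonneg (by linarith)]
  ring

/-- Bounded distance from `c` and convexity make `busemann c` fall at unit speed along `c'`; compare
`x` with far points of `c'`. -/
theorem busemann_asymptotic_le (hX : IsCAT0 X) {c c' : GeodesicRay X} (h : c ≈ c') (x : X) :
    busemann c x ≤ busemann c (c'.1 0) + busemann c' x := by
  obtain ⟨K, hK⟩ := h
  have hray : ∀ t : ℝ≥0, busemann c (c'.1 t) + t ≤ busemann c (c'.1 0) := by
    intro t
    refine le_of_sublinear (e := fun _ => K) (fun n hn => ?_) (tendsto_const_div_atTop_nhds_zero_nat K)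
    have hn' : (1 : ℝ) ≤ n := by exact_mod_cast hn
    have hn0 : (0 : ℝ) < n := by linarith
    have h1 := convexFn_busemann hX c _ _ _ _ (by positivity) ((div_le_one hn0).2 hn') (c'.isAt t hn)
    have h2 := busemann_sub_le c (c'.1 (n * t)) (c.1 (n * t))
    have h3 := hK (n * t)
    rw [busemann_self, dist_comm] at h2
    push_cast at h2
    have h4 := mul_le_mul_of_nonneg_left
      (show busemann c (c'.1 (n * t)) ≤ K - n * t by linarith) (one_div_pos.2 hn0).le
    have h5 : 1 / (n : ℝ) * (K - n * t) = 1 / n * K - t := by field_simp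
    linarith
  refine ge_of_tendsto' ((tendsto_busemann c' x).const_add (busemann c (c'.1 0))) fun n => ?_
  have h1 := hray n
  have h2 := busemann_sub_le c x (c'.1 n)
  rw [NNReal.coe_natCast] at h1
  linarith

theorem busemann_asymptotic_swap_le (hX : IsCAT0 X) {c c' : GeodesicRay X} (h : c ≈ c') :
    busemann c (c'.1 0) + busemann c' (c.1 0) ≤ 0 := by
  obtain ⟨K, hK⟩ := h
  have lim := (tendsto_busemann c (c'.1 0)).add (tendsto_busemann c' (c.1 0))
  refine le_of_tendsto_of_tendsto lim (tendsto_const_div_atTop_nhds_zero_nat (K ^ 2)) ?_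
  filter_upwards [eventually_gt_atTop 0] with n hn
  have hn0 : (0 : ℝ) < n := by exact_mod_cast hn
  rw [le_div_iff₀ hn0]
  -- Two sides are `n` and the others at most `K`, so the diagonals exceed `n` by at most `K ^ 2 /
  -- n` in total.
  have hq := hX.quadrilateral (c.1 0) (c.1 n) (c'.1 n) (c'.1 0)
  have e1 := c.dist_natCast (Nat.zero_le n)
  have e2 := c'.dist_natCast (Nat.zero_le n)
  have k1 := pow_le_pow_left₀ dist_nonneg (hK n) 2
  have k2 := pow_le_pow_left₀ dist_nonneg (hK 0) 2
  simp only [Nat.cast_zero, sub_zero] at e1 e2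
  rw [e1, dist_comm (c'.1 n) (c'.1 0), e2, dist_comm (c'.1 0) (c.1 0)] at hq
  rw [dist_comm (c'.1 0) (c.1 n)]
  nlinarith [sq_nonneg (dist (c.1 0) (c'.1 n) - n), sq_nonneg (dist (c.1 n) (c'.1 0) - n)]

theorem busemann_asymptotic (hX : IsCAT0 X) {c c' : GeodesicRay X} (h : c ≈ c') (x : X) :
    busemann c x = busemann c' x + busemann c (c'.1 0) := by
  have h1 := busemann_asymptotic_le hX h x
  have h2 := busemann_asymptotic_le hX (Setoid.symm h) x
  have h3 := busemann_asymptotic_swap_le hX h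
  linarith

theorem busemann_smul {G : Type v} [Group G] [MulAction G X] [IsIsometricSMul G X]
    (hX : IsCAT0 X) {c : GeodesicRay X} {ξ : Boundary X} (hc : Quotient.mk _ c = ξ) {g : G}
    (hg : g • ξ = ξ) :
    ∃ k : ℝ, ∀ x, busemann c (g • x) = busemann c x + k := by
  subst hc
  set c' : GeodesicRay X := ⟨fun t => g • c.1 t, (isometry_smul X g).comp c.2⟩ with hc'
  have h : c' ≈ c := Quotient.exact hg
  refine ⟨busemann c (c'.1 0), fun x => ?_⟩
  rw [busemann_asymptotic hX (Setoid.symm h)]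
  congr 1
  simp only [busemann, hc', dist_smul]

end Busemann

/-! ### Unit-speed descent from every point -/

section Flow

variable {X : Type u} [MetricSpace X] {G : Type v} [Group G] [MulAction G X]
  [IsIsometricSMul G X] [TopologicalSpace G] [IsTopologicalGroup G] [ContinuousSMul G X]
  [ProperSpace X]

/-- If a quasi-invariant affine `1`-Lipschitz function decreases at unit speed between two points
at distance `R`, then it does so from every point. -/
theorem exists_unit_descent (hX : IsCAT0 X) (hmin : ActsMinimally G X)
    (hfix : ¬ HasFixedPointAtInfinity G X) {Γ : Subgroup G} (hΓ : HasFiniteInvariantCovolume Γ)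
    {f : X → ℝ} (hf : AffineFn f) (hL : ∀ x y, f x - f y ≤ 1 * dist x y)
    (hq : ∀ γ ∈ Γ, ∃ k : ℝ, ∀ x, f (γ • x) = f x + k) {R : ℝ} {x₀ y₀ : X}
    (hR : dist x₀ y₀ = R) (hxy : f y₀ = f x₀ - R) (x : X) :
    ∃ y, dist x y = R ∧ f y = f x - R := by
  have hR0 : 0 ≤ R := hR ▸ dist_nonneg
  have hex : ∀ x : X, ∃ y ∈ Metric.closedBall x R, ∀ w ∈ Metric.closedBall x R, f y ≤ f w :=
    fun x => (isCompact_closedBall x R).exists_isMinOn ⟨x, Metric.mem_closedBall_self hR0⟩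
      (continuous_of_sub_le hL).continuousOn
  choose y hy hmin' using hex
  simp only [Metric.mem_closedBall'] at hy hmin'
  -- The minimum of `f` over the `R`-ball is convex in the centre, and subtracting `f` preserves
  -- this because `f` is affine.
  have hconv : ConvexFn fun x => f (y x) - f x := by
    intro p q z t h0 h1 hz
    obtain ⟨r, hr⟩ := hX.exists_isAt (y p) (y q) h0 h1
    have h2 := hX.dist_convex h0 h1 hz hr
    have h3 := hmin' z r (by nlinarith [hy p, hy q])
    have h4 := hf _ _ _ t h0 h1 hr
    have h5 := hf _ _ _ t h0 h1 hz
    linarith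
  -- One unit comes from pulling `y q` back into the ball around `p`, the other from `f` itself.
  have hlip : ∀ p q, (f (y p) - f p) - (f (y q) - f q) ≤ 2 * dist p q := by
    intro p q
    obtain ⟨r, hr1, hr2⟩ : ∃ r, dist p r ≤ R ∧ dist r (y q) ≤ dist p q := by
      have htri := dist_triangle p q (y q)
      rcases le_or_gt (dist p (y q)) R with hle | hlt
      · exact ⟨y q, hle, by rw [dist_self]; exact dist_nonneg⟩
      · have hpos : 0 < dist p (y q) := hR0.trans_lt hlt
        obtain ⟨r, hr⟩ := hX.exists_isAt p (y q) (t := R / dist p (y q)) (by positivity)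
          ((div_le_one hpos).2 hlt.le)
        refine ⟨r, ?_, ?_⟩
        · rw [hr.left, div_mul_cancel₀ _ hpos.ne']
        · rw [hr.right, sub_mul, div_mul_cancel₀ _ hpos.ne']
          linarith [hy q]
    have h1 := hmin' p r hr1
    have h2 := hL r (y q)
    have h3 := hL q p
    rw [dist_comm] at h3
    linarith
  have hle : ∀ γ ∈ Γ, ∀ x, f (y (γ • x)) - f (γ • x) ≤ f (y x) - f x := by
    intro γ hγ x
    obtain ⟨k, hk⟩ := hq γ hγ
    have := hmin' (γ • x) (γ • y x) (by rw [dist_smul]; exact hy x)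
    rw [hk] at this ⊢
    linarith
  have hconst := const_of_invariant hX hmin hfix hΓ hconv hlip (fun γ hγ x =>
    le_antisymm (hle γ hγ x) (by simpa only [inv_smul_smul] using hle γ⁻¹ (Γ.inv_mem hγ) (γ • x)))
    x x₀
  have h1 := hmin' x₀ y₀ hR.le
  have h2 := hL x (y x)
  have h3 := hy x
  exact ⟨y x, by linarith, by linarith⟩

end Flow

/-! ### Splitting off a line -/

section Splitting

variable {X : Type u} [MetricSpace X]

/-- The midpoint of `y` and `z` is also at level `b x + t`, hence at distance at least `|t|` from
`x`; Bruhat–Tits then leaves no room between `y` and `z`. -/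
theorem eq_of_unit_ascent (hX : IsCAT0 X) {b : X → ℝ} (hb : AffineFn b)
    (hL : ∀ x y, b x - b y ≤ 1 * dist x y) {x y z : X} {t : ℝ} (hy : dist x y ≤ |t|)
    (hby : b y = b x + t) (hz : dist x z ≤ |t|) (hbz : b z = b x + t) : y = z := by
  obtain ⟨m, hm⟩ := hX.exists_isAt y z (t := 1 / 2) (by norm_num) (by norm_num)
  have h1 := hb _ _ _ _ (by norm_num) (by norm_num) hm
  have h2 := hX.dist_sq_midpoint_le hm x
  have h3 : |t| ≤ dist x m := by
    have e1 := hL x m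
    have e2 := hL m x
    rw [dist_comm] at e2
    exact abs_le.2 ⟨by linarith, by linarith⟩
  have h4 := pow_le_pow_left₀ (abs_nonneg t) h3 2
  have h5 := pow_le_pow_left₀ dist_nonneg hy 2
  have h6 := pow_le_pow_left₀ dist_nonneg hz 2
  have h7 : dist y z ^ 2 ≤ 0 := by linarith
  exact dist_eq_zero.1 (pow_eq_zero_iff two_ne_zero |>.1 (le_antisymm h7 (sq_nonneg _)))

/-- A translation-like flow along an affine function. -/
structure UnitFlow (b : X → ℝ) (ψ : X → ℝ → X) : Prop where
  dist_eq : ∀ x t, dist x (ψ x t) = |t|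
  apply_eq : ∀ x t, b (ψ x t) = b x + t
  unique : ∀ x y t, dist x y ≤ |t| → b y = b x + t → y = ψ x t

namespace UnitFlow

variable {b : X → ℝ} {ψ : X → ℝ → X}

theorem neg_cancel (h : UnitFlow b ψ) (x : X) (s : ℝ) : ψ (ψ x s) (-s) = x :=
  (h.unique _ _ _ (by rw [dist_comm, h.dist_eq, abs_neg]) (by rw [h.apply_eq]; ring)).symm

theorem add_of_abs (h : UnitFlow b ψ) (x : X) {s t : ℝ} (hst : |s + t| = |s| + |t|) :
    ψ (ψ x s) t = ψ x (s + t) := by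
  refine h.unique _ _ _ ?_ (by rw [h.apply_eq, h.apply_eq]; ring)
  refine (dist_triangle _ (ψ x s) _).trans ?_
  rw [h.dist_eq, h.dist_eq, hst]

theorem add (h : UnitFlow b ψ) (x : X) (s t : ℝ) : ψ (ψ x s) t = ψ x (s + t) := by
  -- One of the three pairs `(s, t)`, `(s + t, -t)`, `(-s, s + t)` has no cancellation; the last two
  -- cases follow by inverting a flow step.
  have : |s + t| = |s| + |t| ∨ |(s + t) + -t| = |s + t| + |-t| ∨
      |-s + (s + t)| = |-s| + |s + t| := by
    rw [add_neg_cancel_right, neg_add_cancel_left, abs_neg, abs_neg]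
    rcases abs_cases s with h1 | h1 <;> rcases abs_cases t with h2 | h2 <;>
      rcases abs_cases (s + t) with h3 | h3 <;> grind
  rcases this with h1 | h1 | h1
  · exact h.add_of_abs x h1
  · have := h.add_of_abs x h1
    rw [add_neg_cancel_right] at this
    rw [← this]
    simpa using h.neg_cancel (ψ x (s + t)) (-t)
  · have := h.add_of_abs (ψ x s) h1
    rw [neg_add_cancel_left, h.neg_cancel] at this
    exact this.symm

theorem zero (h : UnitFlow b ψ) (x : X) : ψ x 0 = x :=
  (h.unique x x 0 (by simp) (by simp)).symm

theorem dist_flow (h : UnitFlow b ψ) (x : X) (s t : ℝ) : dist (ψ x s) (ψ x t) = |t - s| := by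
  have := h.dist_eq (ψ x s) (t - s)
  rwa [h.add, add_sub_cancel] at this

theorem isAt (h : UnitFlow b ψ) (x : X) (t : ℝ) {n : ℕ} (hn : 0 < n) :
    IsAt x (ψ x (n * t)) (1 / (n : ℝ)) (ψ x t) := by
  have hn' : (1 : ℝ) ≤ n := by exact_mod_cast hn
  constructor
  · rw [h.dist_eq, h.dist_eq, abs_mul, Nat.abs_cast]
    field_simp
  · rw [h.dist_flow, h.dist_eq, abs_mul, Nat.abs_cast,
      show (n : ℝ) * t - t = (n - 1) * t by ring, abs_mul, abs_of_nonneg (by linarith)]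
    field_simp

theorem isAt_half (h : UnitFlow b ψ) (x : X) (t u : ℝ) :
    IsAt (ψ x t) (ψ x u) (1 / 2) (ψ x ((t + u) / 2)) := by
  constructor
  · rw [h.dist_flow, h.dist_flow, show (t + u) / 2 - t = 1 / 2 * (u - t) by ring, abs_mul,
      abs_of_nonneg (by norm_num : (0 : ℝ) ≤ 1 / 2)]
  · rw [h.dist_flow, h.dist_flow, show u - (t + u) / 2 = (1 - 1 / 2) * (u - t) by ring, abs_mul,
      abs_of_nonneg (by norm_num : (0 : ℝ) ≤ 1 - 1 / 2)]

theorem dist_flow_le (hX : IsCAT0 X) (hb : AffineFn b) (hL : ∀ x y, b x - b y ≤ 1 * dist x y)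
    (h : UnitFlow b ψ) (x y : X) (t : ℝ) :
    dist (ψ x t) (ψ y t) ≤ dist x y := by
  set D := dist x y with hD
  have hD0 : 0 ≤ D := dist_nonneg
  -- The level of the midpoint keeps it far from `x`, so the flow lines separate at most like the
  -- square root of time, and convexity finishes.
  have grow : ∀ s : ℝ, dist (ψ x s) (ψ y s) ^ 2 ≤ 8 * |s| * D + 2 * D ^ 2 := by
    intro s
    obtain ⟨m, hm⟩ := hX.exists_isAt (ψ x s) (ψ y s) (t := 1 / 2) (by norm_num) (by norm_num)
    have h1 := hb _ _ _ _ (by norm_num) (by norm_num) hm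
    rw [h.apply_eq, h.apply_eq] at h1
    have h2 := hX.dist_sq_midpoint_le hm x
    have e1 := hL x m
    have e2 := hL m x
    have e3 := hL x y
    have e4 := hL y x
    rw [dist_comm] at e2 e4
    have h3 : (s - (b x - b y) / 2) ^ 2 ≤ dist x m ^ 2 := sq_le_sq' (by linarith) (by linarith)
    have h4 : s * (b x - b y) ≤ |s| * D := by
      refine (le_abs_self _).trans ?_
      rw [abs_mul]
      exact mul_le_mul_of_nonneg_left (abs_le.2 ⟨by linarith, by linarith⟩) (abs_nonneg s)
    have hs := sq_abs s
    have h5 := dist_triangle x y (ψ y s)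
    rw [h.dist_eq] at h5
    have h6 := pow_le_pow_left₀ dist_nonneg h5 2
    rw [h.dist_eq] at h2
    nlinarith [sq_nonneg (b x - b y)]
  refine le_of_sublinear (e := fun n => dist (ψ x (n * t)) (ψ y (n * t))) (fun n hn => ?_)
    (tendsto_div_zero_of_sq_le fun ε hε => ?_)
  · have hn' : (1 : ℝ) ≤ n := by exact_mod_cast hn
    exact hX.dist_convex (by positivity) ((div_le_one (by linarith)).2 hn') (h.isAt x t hn)
      (h.isAt y t hn)
  · have lim : Tendsto (fun n : ℕ => (8 * |t| * D + 2 * D ^ 2) / (n : ℝ)) atTop (𝓝 0) :=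
      tendsto_const_div_atTop_nhds_zero_nat _
    filter_upwards [lim.eventually_lt_const hε, eventually_gt_atTop 0] with n h1 hn
    have hn' : (1 : ℝ) ≤ n := by exact_mod_cast hn
    have hn0 : (0 : ℝ) < n := by linarith
    refine le_trans ?_ h1.le
    rw [div_pow, div_le_div_iff₀ (by positivity) hn0]
    have h2 := grow (n * t)
    rw [abs_mul, Nat.abs_cast] at h2
    have h3 : 2 * D ^ 2 ≤ 2 * D ^ 2 * n := le_mul_of_one_le_right (by positivity) hn'
    nlinarith

theorem dist_flow_eq (hX : IsCAT0 X) (hb : AffineFn b) (hL : ∀ x y, b x - b y ≤ 1 * dist x y)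
    (h : UnitFlow b ψ) (x y : X) (t : ℝ) :
    dist (ψ x t) (ψ y t) = dist x y := by
  refine le_antisymm (dist_flow_le hX hb hL h x y t) ?_
  have := dist_flow_le hX hb hL h (ψ x t) (ψ y t) (-t)
  rwa [h.neg_cancel, h.neg_cancel] at this

/-- Pythagoras' theorem for flow lines. -/
theorem dist_sq (hX : IsCAT0 X) (hb : AffineFn b) (hL : ∀ x y, b x - b y ≤ 1 * dist x y)
    (h : UnitFlow b ψ) {x y : X} (hxy : b x = b y) (t : ℝ) :
    dist x (ψ y t) ^ 2 = dist x y ^ 2 + t ^ 2 := by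
  -- The Pythagorean defect `k` at least doubles when `s` does, but `hodd` and `hlow` bound it
  -- above; so `k ≤ 0`. The midpoint of `ψ y t` and `ψ y (-t)` is `y`, giving `k t + k (-t) ≥ 0`.
  set k : ℝ → ℝ := fun s => dist x (ψ y s) ^ 2 - s ^ 2 - dist x y ^ 2 with hk
  have hlow : ∀ s, -dist x y ^ 2 ≤ k s := by
    intro s
    have e1 := hL (ψ y s) x
    have e2 := hL x (ψ y s)
    rw [dist_comm] at e1
    rw [h.apply_eq, hxy] at e1 e2
    have : |s| ≤ dist x (ψ y s) := abs_le.2 ⟨by linarith, by linarith⟩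
    have := pow_le_pow_left₀ (abs_nonneg s) this 2
    rw [sq_abs] at this
    simp only [hk]
    linarith
  have hodd : ∀ s, k s + k (-s) ≤ 0 := by
    intro s
    have hq := hX.quadrilateral x (ψ x s) (ψ y s) y
    have e : dist (ψ x s) y = dist x (ψ y (-s)) := by
      have := dist_flow_eq hX hb hL h (ψ x s) y (-s)
      rw [h.neg_cancel] at this
      exact this.symm
    rw [h.dist_eq, dist_flow_eq hX hb hL h, dist_comm (ψ y s) y, h.dist_eq, sq_abs, e,
      dist_comm y x] at hq
    simp only [hk]
    nlinarith
  have hdouble : ∀ s, 2 * k s ≤ k (2 * s) := by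
    intro s
    have hm := hX.dist_sq_midpoint_le (h.isAt_half y 0 (2 * s)) x
    rw [h.zero, h.dist_eq, sq_abs, show (0 + 2 * s) / 2 = s by ring] at hm
    simp only [hk]
    nlinarith
  have hpow : ∀ (n : ℕ) s, 2 ^ n * k s ≤ k (2 ^ n * s) := by
    intro n s
    induction n with
    | zero => simp
    | succ n ih =>
      have := hdouble (2 ^ n * s)
      rw [pow_succ', mul_assoc, mul_assoc]
      linarith
  have hnonpos : ∀ s, k s ≤ 0 := by
    intro s
    by_contra! hpos
    obtain ⟨n, hn⟩ := pow_unbounded_of_one_lt (dist x y ^ 2 / k s) one_lt_two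
    rw [div_lt_iff₀ hpos] at hn
    have h1 := hpow n s
    have h2 := hodd (2 ^ n * s)
    have h3 := hlow (-(2 ^ n * s))
    linarith
  have hzero : k t = 0 := by
    have h0 : 0 ≤ k t + k (-t) := by
      have hm := hX.dist_sq_midpoint_le (h.isAt_half y t (-t)) x
      rw [h.dist_flow, sq_abs, show (t + -t) / 2 = 0 by ring, h.zero] at hm
      simp only [hk]
      nlinarith
    linarith [hnonpos t, hnonpos (-t)]
  simp only [hk] at hzero
  linarith

end UnitFlow

/-- A space with an affine function all of whose gradient lines are complete splits off a line. -/
theorem hasEuclideanFactor_of_unitFlow (hX : IsCAT0 X) {b : X → ℝ} (hb : AffineFn b)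
    (hL : ∀ x y, b x - b y ≤ 1 * dist x y) {ψ : X → ℝ → X} (h : UnitFlow b ψ) :
    HasEuclideanFactor X := by
  let Φ : WithLp 2 ({x : X // b x = 0} × EuclideanSpace ℝ (Fin 1)) → X :=
    fun p => ψ p.fst.1 (p.snd 0)
  have hΦ : Isometry Φ := by
    refine Isometry.of_dist_eq fun p q => ?_
    have hpq : b p.fst.1 = b q.fst.1 := by rw [p.fst.2, q.fst.2]
    have h1 : dist (Φ p) (Φ q) ^ 2 = dist p.fst.1 q.fst.1 ^ 2 + (q.snd 0 - p.snd 0) ^ 2 := by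
      have := UnitFlow.dist_sq hX hb hL h (x := ψ p.fst.1 (p.snd 0)) (y := ψ q.fst.1 (p.snd 0))
        (by rw [h.apply_eq, h.apply_eq, hpq]) (q.snd 0 - p.snd 0)
      rwa [h.add, add_sub_cancel, UnitFlow.dist_flow_eq hX hb hL h] at this
    have h2 : dist p q ^ 2 = dist p.fst.1 q.fst.1 ^ 2 + (q.snd 0 - p.snd 0) ^ 2 := by
      rw [WithLp.prod_dist_eq_add (by norm_num), ENNReal.toReal_ofNat, ← Real.sqrt_eq_rpow,
        Real.sq_sqrt (by positivity), Real.rpow_two, Real.rpow_two, EuclideanSpace.dist_eq,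
        Real.sq_sqrt (by positivity), Fin.sum_univ_one, Real.dist_eq, sq_abs, Subtype.dist_eq]
      ring
    exact (pow_left_inj₀ dist_nonneg dist_nonneg two_ne_zero).1 (h1.trans h2.symm)
  have hsurj : Function.Surjective Φ := by
    intro x
    refine ⟨WithLp.toLp 2 (⟨ψ x (-b x), by rw [h.apply_eq]; ring⟩, !₂[b x]), ?_⟩
    show ψ (ψ x (-b x)) (b x) = x
    simpa using h.neg_cancel x (-b x)
  exact ⟨1, le_rfl, {x : X // b x = 0}, inferInstance,
    ⟨(IsometryEquiv.mk (Equiv.ofBijective Φ ⟨hΦ.injective, hsurj⟩) hΦ).symm⟩⟩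

end Splitting

/-! ### Excluding fixed points at infinity, and the theorem -/

section Main

variable {X : Type u} [MetricSpace X] {G : Type v} [Group G] [MulAction G X]
  [IsIsometricSMul G X] [TopologicalSpace G] [IsTopologicalGroup G] [ContinuousSMul G X]
  [ProperSpace X]

theorem not_hasFixedPointAtInfinity_of_finiteCovolume (hX : IsCAT0 X)
    (hE : ¬ HasEuclideanFactor X) (hmin : ActsMinimally G X)
    (hfix : ¬ HasFixedPointAtInfinity G X) {Γ : Subgroup G}
    (hΓ : HasFiniteInvariantCovolume Γ) : ¬ HasFixedPointAtInfinity Γ X := by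
  rintro ⟨ξ, hξ⟩
  obtain ⟨c, hc⟩ := Quotient.exists_rep ξ
  have hq : ∀ γ ∈ Γ, ∃ k : ℝ, ∀ x, busemann c (γ • x) = busemann c x + k :=
    fun γ hγ => busemann_smul (G := Γ) hX hc (hξ ⟨γ, hγ⟩)
  have hL := busemann_sub_le c
  have hb := affineFn_of_quasiInvariant hX hmin hfix hΓ (convexFn_busemann hX c) hL hq
  have hdist : ∀ R : ℝ≥0, dist (c.1 0) (c.1 R) = R := fun R => by
    rw [c.2.dist_eq, NNReal.dist_eq, NNReal.coe_zero, zero_sub, abs_neg, NNReal.abs_eq]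
  have hflow : ∀ x (t : ℝ), ∃ y, dist x y = |t| ∧ busemann c y = busemann c x + t := by
    intro x t
    have h0 : busemann c (c.1 0) = 0 := by rw [busemann_self]; simp
    rcases le_total t 0 with ht | ht
    · obtain ⟨R, hR⟩ : ∃ R : ℝ≥0, (R : ℝ) = -t := ⟨⟨-t, by linarith⟩, rfl⟩
      obtain ⟨y, h1, h2⟩ := exists_unit_descent hX hmin hfix hΓ hb hL hq (hdist R)
        (by rw [busemann_self, h0, zero_sub]) x
      exact ⟨y, by rw [h1, abs_of_nonpos ht, hR], by rw [h2, hR]; ring⟩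
    -- Ascent is descent for the negated Busemann function, with the model segment of `c` traversed
    -- backwards; affineness makes the negative admissible.
    · obtain ⟨R, hR⟩ : ∃ R : ℝ≥0, (R : ℝ) = t := ⟨⟨t, ht⟩, rfl⟩
      obtain ⟨y, h1, h2⟩ := exists_unit_descent hX hmin hfix hΓ hb.neg
        (fun x y => by rw [dist_comm]; linarith [hL y x])
        (fun γ hγ => (hq γ hγ).imp' Neg.neg fun k hk x => by rw [hk]; ring)
        ((dist_comm _ _).trans (hdist R)) (by rw [h0, busemann_self]; ring) x
      exact ⟨y, by rw [h1, abs_of_nonneg ht, hR], by linarith⟩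
  choose ψ hψ1 hψ2 using hflow
  exact hE (hasEuclideanFactor_of_unitFlow hX hb hL (ψ := ψ) ⟨hψ1, hψ2, fun x y t h1 h2 =>
    eq_of_unit_ascent hX hb hL h1 h2 (hψ1 x t).le (hψ2 x t)⟩)

end Main

end GeometricDensity

theorem theorem2p4 {X : Type*} [MetricSpace X] [ProperSpace X]
    (hX : GeometricDensity.IsCAT0 X) (hE : ¬ GeometricDensity.HasEuclideanFactor X)
    {G : Type*} [Group G] [TopologicalSpace G] [IsTopologicalGroup G] [T2Space G]
    [LocallyCompactSpace G] [MulAction G X] [IsIsometricSMul G X] [ContinuousSMul G X]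
    (hmin : GeometricDensity.ActsMinimally G X)
    (hfix : ¬ GeometricDensity.HasFixedPointAtInfinity G X) :
    (∀ Γ : Subgroup G, IsClosed (Γ : Set G) → GeometricDensity.HasFiniteInvariantCovolume Γ →
      GeometricDensity.ActsMinimally Γ X ∧ ¬ GeometricDensity.HasFixedPointAtInfinity Γ X) ∧
    (∀ Γ : Subgroup G, GeometricDensity.IsLattice Γ →
      GeometricDensity.ActsMinimally Γ X ∧ ¬ GeometricDensity.HasFixedPointAtInfinity Γ X) := by
  have main : ∀ Γ : Subgroup G, GeometricDensity.HasFiniteInvariantCovolume Γ →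
      GeometricDensity.ActsMinimally Γ X ∧ ¬ GeometricDensity.HasFixedPointAtInfinity Γ X :=
    fun Γ hΓ => ⟨GeometricDensity.actsMinimally_of_finiteCovolume hX hmin hfix hΓ,
      GeometricDensity.not_hasFixedPointAtInfinity_of_finiteCovolume hX hE hmin hfix hΓ⟩
  exact ⟨fun Γ _ hΓ => main Γ hΓ, fun Γ hΓ => main Γ hΓ.2⟩
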